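/- Let $X$ be a real reflexive Banach space, let $Z$ be a real Hausdorff locally convex topological vector space, and let $C\subseteq Z$ be a convex pointed cone, that is, $tc\in C$ for all $c\in C$ and $t\ge 0$, $C+C=C$, and $C\cap(-C)=\{0\}$. Here $-C\setminus\{0\}$ denotes $(-C)\setminus\{0\}$. Let $K\subseteq X$ be nonempty, convex and closed, and let $D\subseteq K$ be self segment-dense in $K$ for the weak topology of $X$; that is, $D$ is weakly dense in $K$, and for all $x,y\in D$ the set $[x,y]\cap D$ is weakly dense in the closed segment $[x,y]$. A map $g:K\to Z$ is called strongly $C$-upper semicontinuous at $x\in K$ in the weak topology if for every $k\in C\setminus\{0\}$ there is a weak neighbourhood $U$ of $x$ such that $g(u)\in g(x)+k-(C\setminus\{0\})$ for all $u\in U\cap K$. It is called $C$-convex on $D$ if $\sum_{i=1}^n\lambda_i g(x_i)-g\left(\sum_{i=1}^n\lambda_i x_i\right)\in C$ whenever $n\in\mathbb N$, $x_1,\dots,x_n\in D$, $\lambda_1,\dots,\lambda_n\ge 0$, $\sum_{i=1}^n\lambda_i=1$ and $\sum_{i=1}^n\lambda_i x_i\in D$. Let $f:K\times K\to Z$ satisfy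 the following conditions. (i) For every $y\in D$, the map $x\mapsto f(x,y)$ is strongly $C$-upper semicontinuous at every point of $K$ in the weak topology of $X$. (ii) For every $x\in K$, the map $y\mapsto f(x,y)$ is strongly $C$-upper semicontinuous at every point of $K\setminus D$ in the weak topology of $X$. (iii) For every $x\in K$, the map $y\mapsto f(x,y)$ is $C$-convex on $D$. (iv) For every $x\in D$, $f(x,x)\notin -C\setminus\{0\}$. (v) There is $r>0$ such that $\{x\in K:\|x\|\le r\}\neq\emptyset$ and, for every $x\in K$ with $\|x\|\le r$, there is $y_0\in D$ with $\|y_0\|<r$ and $f(x,y_0)\in -C$. Then there is $x_0\in K$ such that $f(x_0,y)\notin -C\setminus\{0\}$ for all $y\in K$. -/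

import Mathlib

open Topology Pointwise

/-- `C` is a convex pointed cone: `t • c ∈ C` for `c ∈ C` and `t ≥ 0`, `C + C = C`,
and `C ∩ (-C) = {0}`. -/
structure IsConvexPointedCone {Z : Type*} [AddCommGroup Z] [Module ℝ Z] (C : Set Z) : Prop where
  smul_mem : ∀ t : ℝ, 0 ≤ t → ∀ c ∈ C, t • c ∈ C
  add_eq : C + C = C
  inter_neg_eq : C ∩ (-C) = {0}

/-- The map `g`, considered on the set `K`, is strongly `C`-upper semicontinuous at `x`:
for every `k ∈ C \ {0}` there is a neighbourhood `U` of `x` such that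
`g u ∈ g x + k - C \ {0}` for all `u ∈ U ∩ K`. Values of `g` outside `K` play no role
when `x ∈ K`. -/
def StronglyUpperSemicontinuousAt {E Z : Type*} [TopologicalSpace E] [AddCommGroup Z]
    (C : Set Z) (K : Set E) (g : E → Z) (x : E) : Prop :=
  ∀ k ∈ C \ {0}, ∃ U ∈ 𝓝 x, ∀ u ∈ U ∩ K, g u ∈ {g x + k} - (C \ {0})

/-- The map `g` is `C`-convex on the (not necessarily convex) set `D`: it satisfies Jensen's
inequality, in the order `a ≤ b ↔ b - a ∈ C`, for every finite convex combination of points of `D`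
that lies again in `D`. -/
def ConeConvexOn {E Z : Type*} [AddCommGroup E] [Module ℝ E] [AddCommGroup Z] [Module ℝ Z]
    (C : Set Z) (D : Set E) (g : E → Z) : Prop :=
  ∀ (n : ℕ) (x : Fin n → E) (w : Fin n → ℝ), (∀ i, x i ∈ D) → (∀ i, 0 ≤ w i) →
    ∑ i, w i = 1 → ∑ i, w i • x i ∈ D →
      ∑ i, w i • g (x i) - g (∑ i, w i • x i) ∈ C

/-- The subset `U` of the convex set `V` is self segment-dense in `V`: `U` is dense in `V`, and for
all `x, y ∈ U` the set `[x, y] ∩ U` is dense in the closed segment `[x, y]`. -/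
structure IsSelfSegmentDense {E : Type*} [TopologicalSpace E] [AddCommGroup E] [Module ℝ E]
    (U V : Set E) : Prop where
  convex : Convex ℝ V
  subset : U ⊆ V
  dense : V ⊆ closure U
  segment_dense : ∀ x ∈ U, ∀ y ∈ U, segment ℝ x y ⊆ closure (segment ℝ x y ∩ U)

/-- A real normed space is reflexive if the canonical embedding into its bidual is onto. -/
def IsReflexiveSpace (X : Type*) [NormedAddCommGroup X] [NormedSpace ℝ X] : Prop :=
  Function.Surjective (NormedSpace.inclusionInDoubleDual ℝ X)

/-! Call `y` bad for `x` when `f x y` lies in `-C` without `0`. Strong upper semicontinuity with `k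
= -f x y` makes badness a weakly open condition, in `x` for fixed `y ∈ D` by (i), and in `y` at
points outside `D` by (ii). If every point of a finite subset of `D` is bad for `u`, then by
Jensen's inequality (iii) and pointedness so is every point of `D` in its convex hull; for `u`
itself this is excluded by (iv).

The part `B` of `K` in the ball of radius `r` is weakly compact by reflexivity. The KKM lemma gives
`x₀ ∈ B` for which no point of `D ∩ B` is bad (`IsCompact.exists_forall_not_of_convexHull`); self
segment-density enters because Jensen is available only at points of `D`, which are dense in each
hull of finitely many of them. For the `y₀` of (v) this forces `f x₀ y₀ = 0`. A bad `y ∈ D` outside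
the ball would make points of `D` on the segment from `y₀` to `y`, close to `y₀` and so inside the
ball, bad as well. Finally (ii) and density pass from `D` to `K`.

KKM is derived from Brouwer's theorem, and Brouwer from Scarf's lemma, a parity argument on finite
families of linear orders. -/

/-! ### Scarf's combinatorial lemma -/

/-- A finite set `S` is dominant for a family `p` of orders on `V` if each point of `V` lies below
all points of `S` in one of the orders. -/
def IsDominant {I V L : Type*} [LinearOrder L] (p : I → V → L) (S : Finset V) : Prop :=
  ∀ y, ∃ i, ∀ x ∈ S, p i y ≤ p i x

/-- The points `s i` are slack points for the orders `p`: `s i` is the least point of the `i`-th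
order, and it is above all points that are not slack points in the other orders. -/
structure IsSlack {I V L : Type*} [LinearOrder L] (p : I → V → L) (s : I → V) : Prop where
  le : ∀ i x, p i (s i) ≤ p i x
  lt : ∀ i j x, i ≠ j → x ∉ Set.range s → p i x < p i (s j)

theorem IsDominant.mono {I V L : Type*} [LinearOrder L] {p : I → V → L} {S S' : Finset V}
    (h : IsDominant p S) (hS : S' ⊆ S) : IsDominant p S' :=
  fun y => (h y).imp fun _ hi x hx => hi x (hS hx)

theorem IsSlack.injective {I V L : Type*} [LinearOrder L] {p : I → V → L} {s : I → V}
    (hs : IsSlack p s) {t : V} (ht : t ∉ Set.range s) : Function.Injective s := by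
  intro i j hij
  by_contra hne
  exact (hs.lt i j t hne ht).not_ge (hij ▸ hs.le i t)

/-- If removing `x` leaves exactly the colours other than `i₀`, then counting shows that each of
them occurs once in the rest. Since `S` itself misses `i₀`, the colour of `x` is repeated at exactly
one `y`, and `x`, `y` are the only removable points: the count is 0 or 2. -/
theorem even_card_filter_image_erase {I V : Type*} [Fintype I] [DecidableEq I] [DecidableEq V]
    {S : Finset V} (hcard : S.card = Fintype.card I)
    (c : V → I) (i₀ : I) (hS : S.image c ≠ Finset.univ) :
    Even (S.filter fun x => (S.erase x).image c = Finset.univ.erase i₀).card := by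
  rcases (S.filter fun x => (S.erase x).image c = Finset.univ.erase i₀).eq_empty_or_nonempty
    with h | ⟨x, hx⟩
  · simp [h]
  obtain ⟨hxS, hx⟩ := Finset.mem_filter.1 hx
  have hI : 0 < Fintype.card I := Fintype.card_pos_iff.2 ⟨i₀⟩
  have hcx : c x ≠ i₀ := by
    intro h
    apply hS
    rw [← Finset.insert_erase hxS, Finset.image_insert, hx, h,
      Finset.insert_erase (Finset.mem_univ _)]
  obtain ⟨y, hy, hyx⟩ := Finset.mem_image.1
    (show c x ∈ (S.erase x).image c by rw [hx]; simpa using hcx)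
  obtain ⟨hyne, hyS⟩ := Finset.mem_erase.1 hy
  have hsymm : (S.erase y).image c = (S.erase x).image c := by
    ext k
    simp only [Finset.mem_image, Finset.mem_erase]
    constructor
    · rintro ⟨z, ⟨hzy, hzS⟩, rfl⟩
      by_cases hzx : z = x
      · exact ⟨y, ⟨hyne, hyS⟩, by rw [hyx, hzx]⟩
      · exact ⟨z, ⟨hzx, hzS⟩, rfl⟩
    · rintro ⟨z, ⟨hzx, hzS⟩, rfl⟩
      by_cases hzy : z = y
      · exact ⟨x, ⟨hyne.symm, hxS⟩, by rw [hzy, hyx]⟩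
      · exact ⟨z, ⟨hzy, hzS⟩, rfl⟩
  have : (S.filter fun x => (S.erase x).image c = Finset.univ.erase i₀) = {x, y} := by
    ext z
    simp only [Finset.mem_filter, Finset.mem_insert, Finset.mem_singleton]
    constructor
    · rintro ⟨hzS, hz⟩
      by_contra! hzne
      have hinj : Set.InjOn c (S.erase z : Finset V) := by
        rw [← Finset.card_image_iff, hz, Finset.card_erase_of_mem (Finset.mem_univ _),
          Finset.card_erase_of_mem hzS, Finset.card_univ, hcard]
      exact hyne (hinj (Finset.mem_coe.2 (Finset.mem_erase.2 ⟨hzne.2.symm, hyS⟩))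
        (Finset.mem_coe.2 (Finset.mem_erase.2 ⟨hzne.1.symm, hxS⟩)) hyx)
    · rintro (rfl | rfl)
      exacts [⟨hxS, hx⟩, ⟨hyS, hsymm.trans hx⟩]
  rw [this, Finset.card_pair hyne.symm]
  exact even_two

section Scarf

variable {I V L : Type*} [Fintype I] [Fintype V] [DecidableEq I] [DecidableEq V] [LinearOrder L]
  {p : I → V → L} {s : I → V}

-- Dominance makes every point of `D` the minimum of `D` in some order. With one point fewer than
-- orders, exactly one pair of orders `i ≠ j` shares its minimum. A point completing `D` must take
-- over as minimum in order `i` or `j`, and dominance forces it to be the largest candidate there: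
-- one completion for each of the two orders.
open Classical in
theorem card_filter_insert_isDominant_eq_two (hp : ∀ i, Function.Injective (p i))
    (hs : IsSlack p s) {D : Finset V} (hD : IsDominant p D) (hcard : D.card + 1 = Fintype.card I)
    {d : V} (hd : d ∈ D) (hds : d ∉ Set.range s) :
    (Finset.univ.filter fun x => x ∉ D ∧ IsDominant p (insert x D)).card = 2 := by
  choose m hmD hm using fun i => D.exists_min_image (p i) ⟨d, hd⟩
  have hsurj : ∀ x ∈ D, ∃ i, m i = x := fun x hx =>
    (hD x).imp fun i hi => hp i ((hm i x hx).antisymm (hi _ (hmD i)))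
  obtain ⟨i, j, hij, hmij⟩ : ∃ i j, i ≠ j ∧ m i = m j := by
    obtain ⟨i, -, j, -, hij, h⟩ := Finset.exists_ne_map_eq_of_card_lt_of_maps_to
      (s := (Finset.univ : Finset I)) (t := D) (f := m) (by rw [Finset.card_univ]; omega)
      (fun i _ => hmD i)
    exact ⟨i, j, hij, h⟩
  have hinj : ∀ i' j', i' ≠ j' → m i' = m j' → ∀ a b, a ≠ i' → b ≠ i' → m a = m b → a = b := by
    intro i' j' hne heq a b ha hb hab
    have him : (Finset.univ.erase i').image m = D := by
      ext x
      simp only [Finset.mem_image, Finset.mem_erase, Finset.mem_univ, and_true]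
      refine ⟨by rintro ⟨k, -, rfl⟩; exact hmD k, fun hx => ?_⟩
      obtain ⟨k, rfl⟩ := hsurj x hx
      by_cases hk : k = i'
      · exact ⟨j', hne.symm, by rw [hk, heq]⟩
      · exact ⟨k, hk, rfl⟩
    have hinj : Set.InjOn m (Finset.univ.erase i' : Finset I) := by
      rw [← Finset.card_image_iff, him, Finset.card_erase_of_mem (Finset.mem_univ _),
        Finset.card_univ]
      omega
    exact hinj (by simpa using ha) (by simpa using hb) hab
  have hpair : ∀ k l, k ≠ l → m k = m l → k = i ∨ k = j := by
    intro k l hkl h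
    by_contra! hk
    by_cases hl : l = i
    · exact hk.2 (hinj i j hij hmij k j hk.1 hij.symm (h.trans (hl ▸ hmij)))
    · exact hkl (hinj i j hij hmij k l hk.1 hl h)
  have hother : ∀ k, k = i ∨ k = j → ∃ l, k ≠ l ∧ m k = m l := by
    rintro k (rfl | rfl)
    exacts [⟨j, hij, hmij⟩, ⟨i, hij.symm, hmij.symm⟩]
  -- `A k` holds the points that can become the new minimum in order `k` without disturbing the
  -- minima in the other orders. The slack point `s k` is one of them, because `d` is not slack.
  let A : I → Finset V := fun k => Finset.univ.filter fun y => ∀ l, l ≠ k → p l (m l) < p l y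
  have hA : ∀ k y, y ∈ A k ↔ ∀ l, l ≠ k → p l (m l) < p l y := fun k y => by simp [A]
  have hAne : ∀ k, (A k).Nonempty := fun k =>
    ⟨s k, (hA k _).2 fun l hl => (hm l d hd).trans_lt (hs.lt l k d hl hds)⟩
  have hAle : ∀ k, ∀ y ∈ A k, ∀ x ∈ D, p k y ≤ p k x := by
    intro k y hy x hx
    obtain ⟨l, hl⟩ := hD y
    by_cases hlk : l = k
    · exact hlk ▸ hl x hx
    · exact absurd (hl _ (hmD l)) ((hA k y).1 hy l hlk).not_ge
  have hAD : ∀ k, k = i ∨ k = j → ∀ y ∈ A k, y ∉ D := by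
    intro k hk y hy hyD
    obtain ⟨l, rfl⟩ := hsurj y hyD
    obtain ⟨k', hkk', hmk⟩ := hother k hk
    by_cases hl : l = k
    · subst hl
      exact absurd ((hA _ _).1 hy k' hkk'.symm) (by rw [hmk]; exact lt_irrefl _)
    · exact lt_irrefl _ ((hA _ _).1 hy l hl)
  have key : ∀ x, (x ∉ D ∧ IsDominant p (insert x D)) ↔
      ∃ k, (k = i ∨ k = j) ∧ x ∈ A k ∧ ∀ y ∈ A k, p k y ≤ p k x := by
    intro x
    constructor
    · rintro ⟨hxD, hx⟩
      obtain ⟨k, hk⟩ := hx x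
      have hlt : ∀ y ∈ D, p k x < p k y := fun y hy =>
        (hk y (Finset.mem_insert_of_mem hy)).lt_of_ne fun h => hxD (hp k h ▸ hy)
      have hex : ∀ y ∈ D, ∃ l, l ≠ k ∧ m l = y ∧ p l y ≤ p l x := by
        intro y hy
        obtain ⟨l, hl⟩ := hx y
        refine ⟨l, ?_, hp l ((hm l y hy).antisymm (hl _ (Finset.mem_insert_of_mem (hmD l)))),
          hl x (Finset.mem_insert_self _ _)⟩
        rintro rfl
        exact (hlt y hy).not_ge (hl x (Finset.mem_insert_self _ _))
      obtain ⟨k', hk'k, hmk, -⟩ := hex (m k) (hmD k)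
      have hxA : x ∈ A k := by
        refine (hA k x).2 fun l hl => ?_
        obtain ⟨l', hl'k, hml, hle⟩ := hex (m l) (hmD l)
        obtain rfl : l' = l := hinj k k' hk'k.symm hmk.symm l' l hl'k hl hml
        exact hle.lt_of_ne fun h => hxD (hp l' h ▸ hmD l')
      refine ⟨k, hpair k k' hk'k.symm hmk.symm, hxA, fun y hy => ?_⟩
      obtain ⟨l, hl⟩ := hx y
      by_cases hlk : l = k
      · exact hlk ▸ hl x (Finset.mem_insert_self _ _)
      · exact absurd (hl _ (Finset.mem_insert_of_mem (hmD l))) ((hA k y).1 hy l hlk).not_ge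
    · rintro ⟨k, hk, hxA, hmax⟩
      refine ⟨hAD k hk x hxA, fun y => ?_⟩
      by_cases hy : y ∈ A k
      · refine ⟨k, fun z hz => ?_⟩
        rcases Finset.mem_insert.1 hz with rfl | hz
        exacts [hmax y hy, hAle k y hy z hz]
      · rw [hA] at hy
        push Not at hy
        obtain ⟨l, hlk, hl⟩ := hy
        refine ⟨l, fun z hz => hl.trans ?_⟩
        rcases Finset.mem_insert.1 hz with rfl | hz
        exacts [((hA k z).1 hxA l hlk).le, hm l z hz]
  choose M hMA hM using fun k => (A k).exists_max_image (p k) (hAne k)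
  rw [Finset.card_eq_two]
  refine ⟨M i, M j, fun h => ?_, ?_⟩
  · exact (hAle i _ (hMA i) _ (hmD i)).not_gt (h ▸ (hA j _).1 (hMA j) i hij)
  · ext x
    simp only [Finset.mem_filter, Finset.mem_univ, true_and, Finset.mem_insert,
      Finset.mem_singleton, key]
    constructor
    · rintro ⟨k, hk, hx, hmax⟩
      have : x = M k := hp k ((hM k x hx).antisymm (hmax _ (hMA k)))
      rcases hk with rfl | rfl
      exacts [Or.inl this, Or.inr this]
    · rintro (rfl | rfl)
      exacts [⟨i, Or.inl rfl, hMA i, hM i⟩, ⟨j, Or.inr rfl, hMA j, hM j⟩]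

-- A non-slack point cannot lie below `s i` in order `i`, so it must be dominated in order `i₀`.
-- Hence the completing point is the `p i₀`-largest non-slack point.
open Classical in
theorem card_filter_insert_isDominant_eq_one (hp : ∀ i, Function.Injective (p i))
    (hs : IsSlack p s) {t : V} (ht : t ∉ Set.range s) (i₀ : I) :
    (Finset.univ.filter fun x => x ∉ (Finset.univ.erase i₀).image s ∧
      IsDominant p (insert x ((Finset.univ.erase i₀).image s))).card = 1 := by
  obtain ⟨M, hMs, hM⟩ := (Finset.univ.filter fun x => x ∉ Set.range s).exists_max_image (p i₀)
    ⟨t, by simpa using ht⟩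
  simp only [Finset.mem_filter, Finset.mem_univ, true_and] at hMs hM
  rw [Finset.card_eq_one]
  refine ⟨M, ?_⟩
  ext x
  simp only [Finset.mem_filter, Finset.mem_univ, true_and, Finset.mem_singleton]
  constructor
  · rintro ⟨hxD, hx⟩
    have hmem : ∀ i, i ≠ i₀ → s i ∈ insert x ((Finset.univ.erase i₀).image s) := fun i hi =>
      Finset.mem_insert_of_mem (Finset.mem_image_of_mem _ (by simpa using hi))
    have hle : ∀ y, y ∉ Set.range s → p i₀ y ≤ p i₀ x := by
      intro y hy
      obtain ⟨i, hi⟩ := hx y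
      by_cases h : i = i₀
      · exact h ▸ hi x (Finset.mem_insert_self _ _)
      · exact absurd ⟨i, hp i ((hs.le i y).antisymm (hi _ (hmem i h)))⟩ hy
    have hxs : x ∉ Set.range s := by
      rintro ⟨i, rfl⟩
      by_cases h : i = i₀
      · subst h
        exact ht ⟨i, hp i ((hs.le i t).antisymm (hle t ht))⟩
      · exact hxD (Finset.mem_image_of_mem _ (by simpa using h))
    exact hp i₀ ((hM x hxs).antisymm (hle M hMs))
  · rintro rfl
    refine ⟨fun h => ?_, fun y => ?_⟩
    · obtain ⟨i, -, hi⟩ := Finset.mem_image.1 h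
      exact hMs ⟨i, hi⟩
    · by_cases hy : y ∈ Set.range s
      · obtain ⟨k, rfl⟩ := hy
        exact ⟨k, fun z _ => hs.le k z⟩
      · refine ⟨i₀, fun z hz => ?_⟩
        rcases Finset.mem_insert.1 hz with rfl | hz
        · exact hM y hy
        · obtain ⟨j, hj, rfl⟩ := Finset.mem_image.1 hz
          exact (hs.lt i₀ j y (Finset.ne_of_mem_erase hj).symm hy).le

open Classical in
/-- **Scarf's lemma**, in the form of a dual of Sperner's lemma. -/
theorem exists_isDominant_image_eq_univ [Nonempty I] (hp : ∀ i, Function.Injective (p i))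
    (hs : IsSlack p s) {t : V} (ht : t ∉ Set.range s) (c : V → I) (hc : ∀ i, c (s i) = i) :
    ∃ S : Finset V, IsDominant p S ∧ S.image c = Finset.univ := by
  by_contra! hno
  obtain ⟨i₀⟩ := ‹Nonempty I›
  -- Incident pairs of a door and a room are counted twice. By rooms (`Q`) the count is even, as no
  -- dominant set has all colours; by doors (`P`) it is odd, as every door has two rooms except
  -- `D₀`, which has one.
  let Room : Finset V → Prop := fun S => S.card = Fintype.card I ∧ IsDominant p S
  let Door : Finset V → Prop := fun D => D.card + 1 = Fintype.card I ∧ IsDominant p D ∧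
    D.image c = Finset.univ.erase i₀
  let P : Finset (Σ _ : Finset V, V) := Finset.univ.sigma fun D =>
    Finset.univ.filter fun x => Door D ∧ x ∉ D ∧ Room (insert x D)
  let Q : Finset (Σ _ : Finset V, V) := Finset.univ.sigma fun S =>
    Finset.univ.filter fun x => Room S ∧ x ∈ S ∧ Door (S.erase x)
  have hPQ : P.card = Q.card := by
    refine Finset.card_nbij' (fun a => ⟨insert a.2 a.1, a.2⟩) (fun a => ⟨a.1.erase a.2, a.2⟩)
      ?_ ?_ ?_ ?_
    · rintro ⟨D, x⟩ h
      simp only [P, Q, Finset.coe_sigma, Finset.mem_coe, Finset.mem_univ, true_and,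
        Finset.mem_filter, Set.mem_sigma_iff] at h ⊢
      exact ⟨h.2.2, Finset.mem_insert_self _ _, by rw [Finset.erase_insert h.2.1]; exact h.1⟩
    · rintro ⟨S, x⟩ h
      simp only [P, Q, Finset.coe_sigma, Finset.mem_coe, Finset.mem_univ, true_and,
        Finset.mem_filter, Set.mem_sigma_iff] at h ⊢
      exact ⟨h.2.2, Finset.notMem_erase _ _, by rw [Finset.insert_erase h.2.1]; exact h.1⟩
    · rintro ⟨D, x⟩ h
      simp only [P, Finset.coe_sigma, Finset.mem_coe, Finset.mem_univ, true_and,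
        Finset.mem_filter, Set.mem_sigma_iff] at h ⊢
      simp [Finset.erase_insert h.2.1]
    · rintro ⟨S, x⟩ h
      simp only [Q, Finset.coe_sigma, Finset.mem_coe, Finset.mem_univ, true_and,
        Finset.mem_filter, Set.mem_sigma_iff] at h ⊢
      simp [Finset.insert_erase h.2.1]
  have hQ : Even Q.card := by
    rw [Finset.card_sigma]
    refine Finset.even_sum _ fun S _ => ?_
    by_cases hS : Room S
    · refine (congrArg (fun A : Finset V => Even A.card) ?_).mpr
        (even_card_filter_image_erase hS.1 c i₀ (hno S hS.2))
      ext x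
      simp only [Finset.mem_filter, Finset.mem_univ, true_and]
      refine ⟨fun h => ⟨h.2.1, h.2.2.2.2⟩, fun h => ⟨hS, h.1, ?_, hS.2.mono (S.erase_subset x), h.2⟩⟩
      rw [Finset.card_erase_add_one h.1, hS.1]
    · simp [hS]
  let D₀ : Finset V := (Finset.univ.erase i₀).image s
  have hsinj := hs.injective ht
  have hI : 0 < Fintype.card I := Fintype.card_pos_iff.2 ⟨i₀⟩
  have hD₀ : Door D₀ := by
    refine ⟨?_, ?_, ?_⟩
    · rw [Finset.card_image_of_injective _ hsinj, Finset.card_erase_of_mem (Finset.mem_univ _),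
        Finset.card_univ]
      omega
    · have h1 := card_filter_insert_isDominant_eq_one hp hs ht i₀
      obtain ⟨x, hx⟩ := Finset.card_pos.1 (h1 ▸ one_pos)
      exact (Finset.mem_filter.1 hx).2.2.mono (Finset.subset_insert _ _)
    · rw [Finset.image_image]
      rw [show c ∘ s = id from funext hc, Finset.image_id]
  have hcount : ∀ D, Door D → (Finset.univ.filter fun x => Door D ∧ x ∉ D ∧ Room (insert x D)) =
      Finset.univ.filter fun x => x ∉ D ∧ IsDominant p (insert x D) := by
    intro D hD
    ext x
    simp only [Finset.mem_filter, Finset.mem_univ, true_and]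
    refine ⟨fun h => ⟨h.2.1, h.2.2.2⟩, fun h => ⟨hD, h.1, ?_, h.2⟩⟩
    rw [Finset.card_insert_of_notMem h.1, hD.1]
  have hP : Odd P.card := by
    rw [Finset.card_sigma, ← Finset.add_sum_erase _ _ (Finset.mem_univ D₀), hcount D₀ hD₀,
      card_filter_insert_isDominant_eq_one hp hs ht i₀]
    refine Odd.add_even odd_one (Finset.even_sum _ fun D hD => ?_)
    by_cases hDoor : Door D
    · by_cases hsub : ∃ d ∈ D, d ∉ Set.range s
      · obtain ⟨d, hd, hds⟩ := hsub
        rw [hcount D hDoor, card_filter_insert_isDominant_eq_two hp hs hDoor.2.1 hDoor.1 hd hds]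
        exact even_two
      -- A door made of slack points only is `D₀`, since `s i` has colour `i` and a door misses
      -- colour `i₀`.
      · push Not at hsub
        refine absurd ?_ (Finset.ne_of_mem_erase hD)
        refine Finset.eq_of_subset_of_card_le (fun d hd => ?_) ?_
        · obtain ⟨k, rfl⟩ := hsub d hd
          refine Finset.mem_image_of_mem _ ?_
          rw [← hDoor.2.2, ← hc k]
          simpa only [hc] using Finset.mem_image_of_mem c hd
        · have := hD₀.1
          have := hDoor.1
          omega
    · simp [hDoor]
  exact (Nat.not_even_iff_odd.2 hP) (hPQ ▸ hQ)

end Scarf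

/-! ### From Scarf's lemma to Brouwer and KKM -/

/-- For every labelling of the grid points of the simplex there is a grid point which for each label
is close either to a point with this label or to the opposite face. -/
theorem exists_grid_point {I : Type*} [Fintype I] [Nonempty I] (N : ℕ) (c : (I → ℕ) → I) :
    ∃ x : I → ℕ, ∑ i, x i = N ∧ ∀ i,
      (∃ x' : I → ℕ, ∑ i, x' i = N ∧ c x' = i ∧
        ∀ j, x j ≤ x' j + Fintype.card I ∧ x' j ≤ x j + Fintype.card I) ∨
      x i ≤ Fintype.card I := by
  classical
  let T := {v : I → ℕ // v ∈ Finset.piAntidiag Finset.univ N}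
  have hT : ∀ v : T, ∑ i, v.1 i = N := fun v => (Finset.mem_piAntidiag.1 v.2).1
  let mk : ∀ v : I → ℕ, ∑ i, v i = N → T := fun v hv =>
    ⟨v, Finset.mem_piAntidiag.2 ⟨hv, fun i _ => Finset.mem_univ i⟩⟩
  let V := T ⊕ I
  let _ : Fintype T := Finset.Subtype.fintype _
  let _ : Fintype V := inferInstanceAs (Fintype (T ⊕ I))
  -- Grid values `1, …, N + 1` lie strictly between the two slack values `0` and `N + 2`; the second
  -- lexicographic component in `p` only breaks ties.
  let q : I → V → ℕ := fun i => Sum.elim (fun v => v.1 i + 1) fun j => if j = i then 0 else N + 2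
  let p : I → V → ℕ ×ₗ Fin (Fintype.card V) := fun i v => toLex (q i v, Fintype.equivFin V v)
  have hp : ∀ i, Function.Injective (p i) := by
    intro i v w h
    have := congrArg (fun a => (ofLex a).2) h
    simpa [p] using this
  have hpq : ∀ i v w, p i v ≤ p i w → q i v ≤ q i w := by
    intro i v w h
    rcases Prod.Lex.toLex_le_toLex.1 h with h | h
    exacts [h.le, h.1.le]
  have hlt : ∀ i v w, q i v < q i w → p i v < p i w := fun i v w h =>
    Prod.Lex.toLex_lt_toLex.2 (Or.inl h)
  have hvN : ∀ (v : T) i, v.1 i ≤ N := fun v i =>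
    (Finset.single_le_sum (fun _ _ => Nat.zero_le _) (Finset.mem_univ i)).trans_eq (hT v)
  have hs : IsSlack p (Sum.inr : I → V) := by
    refine ⟨fun i x => ?_, fun i j x hij hx => hlt i _ _ ?_⟩
    · rcases x with v | j
      · exact (hlt i _ _ (by simp [q])).le
      · by_cases h : j = i
        · rw [h]
        · exact (hlt i _ _ (by simp [q, h])).le
    · rcases x with v | k
      · have := hvN v i
        simp only [q, Sum.elim_inl, Sum.elim_inr, if_neg hij.symm]
        omega
      · exact absurd ⟨k, rfl⟩ hx
  obtain ⟨a⟩ := ‹Nonempty I›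
  have htN : ∑ i, (Pi.single a N : I → ℕ) i = N := by simp
  obtain ⟨S, hS, hcS⟩ := exists_isDominant_image_eq_univ (I := I) hp hs
    (t := Sum.inl (mk _ htN)) (by simp) (Sum.elim (fun v => c v.1) id) (fun i => rfl)
  have hcol : ∀ i, Sum.inr i ∈ S ∨ ∃ v : T, Sum.inl v ∈ S ∧ c v.1 = i := by
    intro i
    obtain ⟨x, hx, hxi⟩ := Finset.mem_image.1 (hcS ▸ Finset.mem_univ i)
    rcases x with v | j
    · exact Or.inr ⟨v, hx, hxi⟩
    · exact Or.inl ((show j = i from hxi) ▸ hx)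
  -- Once `S` contains the slack point of `i`, order `i` cannot dominate a grid point, so only the
  -- orders in `C` count.
  let C : Finset I := Finset.univ.filter fun i => Sum.inr i ∉ S
  have hdom : ∀ v : T, ∃ i ∈ C, ∀ x : T, Sum.inl x ∈ S → v.1 i ≤ x.1 i := by
    intro v
    obtain ⟨i, hi⟩ := hS (Sum.inl v)
    refine ⟨i, ?_, fun x hx => ?_⟩
    · simp only [C, Finset.mem_filter, Finset.mem_univ, true_and]
      intro h
      simpa [q] using hpq _ _ _ (hi _ h)
    · simpa [q] using hpq _ _ _ (hi _ hx)
  obtain ⟨i₁, hi₁, -⟩ := hdom (mk _ htN)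
  obtain ⟨x₀, hx₀⟩ : ∃ x : T, Sum.inl x ∈ S := by
    rcases hcol i₁ with h | ⟨v, hv, -⟩
    exacts [absurd h (Finset.mem_filter.1 hi₁).2, ⟨v, hv⟩]
  choose m hmS hm using fun i =>
    (Finset.univ.filter fun x : T => (Sum.inl x : V) ∈ S).exists_min_image (fun x => x.1 i)
      ⟨x₀, by simpa using hx₀⟩
  replace hm : ∀ i (x : T), Sum.inl x ∈ S → (m i).1 i ≤ x.1 i := fun i x hx =>
    hm i x (by simpa using hx)
  replace hmS : ∀ i, Sum.inl (m i) ∈ S := fun i => by simpa using hmS i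
  -- Otherwise some grid point exceeds all the minima over `S` on `C`, the surplus being put on
  -- `i₁`, and it is not dominated. Since coordinates sum to `N`, this bound leaves each grid point
  -- of `S` little room above the minima on `C` and little mass off `C`.
  have hsum : N < ∑ i ∈ C, ((m i).1 i + 1) := by
    by_contra! hle
    let v : I → ℕ := fun i => (if i ∈ C then (m i).1 i + 1 else 0) +
      if i = i₁ then N - ∑ i ∈ C, ((m i).1 i + 1) else 0
    have hv : ∑ i, v i = N := by
      simp only [v, Finset.sum_add_distrib, Finset.sum_ite_mem, Finset.univ_inter,
        Finset.sum_ite_eq', Finset.mem_univ, if_true]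
      simp only [Finset.sum_add_distrib] at hle
      omega
    obtain ⟨i, hi, h⟩ := hdom (mk v hv)
    have := h _ (hmS i)
    simp only [mk, v, if_pos hi] at this
    omega
  have hcard : C.card ≤ Fintype.card I := Finset.card_le_univ C
  rw [Finset.sum_add_distrib, ← Finset.card_eq_sum_ones] at hsum
  have hC : ∀ x : T, Sum.inl x ∈ S → ∀ i ∈ C, x.1 i ≤ (m i).1 i + Fintype.card I := by
    intro x hx i hi
    have h1 : ∑ j ∈ C, x.1 j ≤ N :=
      (Finset.sum_le_univ_sum_of_nonneg (by simp)).trans_eq (hT x)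
    have h2 : ∑ j ∈ C.erase i, (m j).1 j ≤ ∑ j ∈ C.erase i, x.1 j :=
      Finset.sum_le_sum fun j _ => hm j x hx
    rw [← Finset.add_sum_erase _ _ hi] at h1 hsum
    omega
  have hC' : ∀ x : T, Sum.inl x ∈ S → ∀ i, i ∉ C → x.1 i ≤ Fintype.card I := by
    intro x hx i hi
    have h1 : ∑ j ∈ insert i C, x.1 j ≤ N :=
      (Finset.sum_le_univ_sum_of_nonneg (by simp)).trans_eq (hT x)
    have h2 : ∑ j ∈ C, (m j).1 j ≤ ∑ j ∈ C, x.1 j := Finset.sum_le_sum fun j _ => hm j x hx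
    rw [Finset.sum_insert hi] at h1
    omega
  have hclose : ∀ x y : T, Sum.inl x ∈ S → Sum.inl y ∈ S → ∀ i, x.1 i ≤ y.1 i + Fintype.card I := by
    intro x y hx hy i
    by_cases hi : i ∈ C
    · have := hC x hx i hi
      have := hm i y hy
      omega
    · have := hC' x hx i hi
      omega
  refine ⟨x₀.1, hT x₀, fun i => ?_⟩
  rcases hcol i with h | ⟨v, hv, hvi⟩
  · exact Or.inr (hC' x₀ hx₀ i (by simpa [C] using h))
  · exact Or.inl ⟨v.1, hT v, hvi, fun j => ⟨hclose _ _ hx₀ hv j, hclose _ _ hv hx₀ j⟩⟩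

/-- **Brouwer's fixed point theorem** for the standard simplex. -/
theorem exists_fixedPoint_stdSimplex {I : Type*} [Fintype I] [Nonempty I]
    {f : stdSimplex ℝ I → stdSimplex ℝ I} (hf : Continuous f) : ∃ x, f x = x := by
  have hcoord : ∀ i, Continuous fun x : stdSimplex ℝ I => x i := fun i =>
    (continuous_apply i).comp continuous_subtype_val
  let g : I → stdSimplex ℝ I → ℝ := fun i x => x i - f x i
  have hg : ∀ i, Continuous (g i) := fun i => (hcoord i).sub ((hcoord i).comp hf)
  have happrox : ∀ ε > 0, ∃ x, ∀ i, g i x ≤ ε := by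
    intro ε hε
    have huc : ∀ i, ∃ δ > 0, ∀ x y : stdSimplex ℝ I, dist x y < δ → dist (g i x) (g i y) < ε :=
      fun i => Metric.uniformContinuous_iff.1
        (CompactSpace.uniformContinuous_of_continuous (hg i)) ε hε
    choose δ hδ hδg using huc
    obtain ⟨i₀, -, hi₀⟩ := Finset.univ.exists_min_image δ Finset.univ_nonempty
    obtain ⟨N, hN⟩ := exists_nat_gt (max ((Fintype.card I : ℝ) / δ i₀) (Fintype.card I / ε))
    have hNpos : (0 : ℝ) < N := lt_of_le_of_lt (by positivity) ((le_max_right _ _).trans_lt hN)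
    have hNδ : (Fintype.card I : ℝ) / N < δ i₀ := by
      rw [div_lt_iff₀ hNpos, mul_comm, ← div_lt_iff₀ (hδ i₀)]
      exact (le_max_left _ _).trans_lt hN
    have hNε : (Fintype.card I : ℝ) / N < ε := by
      rw [div_lt_iff₀ hNpos, mul_comm, ← div_lt_iff₀ hε]
      exact (le_max_right _ _).trans_lt hN
    have hmem : ∀ v : I → ℕ, ∑ i, v i = N → (fun i => (v i : ℝ) / N) ∈ stdSimplex ℝ I := by
      intro v hv
      refine ⟨fun i => by positivity, ?_⟩
      rw [← Finset.sum_div, ← Nat.cast_sum, hv, div_self hNpos.ne']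
    have hneg : ∀ x, ∃ i, g i x ≤ 0 := by
      intro x
      by_contra! h
      have : 0 < ∑ i, g i x := Finset.sum_pos (fun i _ => h i) Finset.univ_nonempty
      simp [g, Finset.sum_sub_distrib] at this
    -- The label of a point is a coordinate that `f` does not decrease; one exists since the `g i`
    -- sum to zero.
    choose c hc using hneg
    let a := Classical.arbitrary I
    obtain ⟨x, hx, hxi⟩ := exists_grid_point N fun v =>
      open Classical in if hv : ∑ i, v i = N then c ⟨_, hmem v hv⟩ else a
    refine ⟨⟨_, hmem x hx⟩, fun i => ?_⟩
    rcases hxi i with ⟨x', hx', rfl, hclose⟩ | hle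
    · rw [dif_pos hx']
      have h0 := hc ⟨_, hmem x' hx'⟩
      set i := c ⟨_, hmem x' hx'⟩
      have hdist : dist (⟨_, hmem x hx⟩ : stdSimplex ℝ I) ⟨_, hmem x' hx'⟩ < δ i := by
        refine lt_of_le_of_lt ?_ (hNδ.trans_le (hi₀ i (Finset.mem_univ i)))
        rw [Subtype.dist_eq, dist_pi_le_iff (by positivity)]
        intro j
        obtain ⟨h1, h2⟩ := hclose j
        have h1' : (x j : ℝ) ≤ x' j + Fintype.card I := by exact_mod_cast h1
        have h2' : (x' j : ℝ) ≤ x j + Fintype.card I := by exact_mod_cast h2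
        rw [Real.dist_eq, ← sub_div, abs_div, abs_of_pos hNpos]
        gcongr
        rw [abs_le]
        constructor <;> linarith
      have := (abs_lt.1 (Real.dist_eq _ _ ▸ hδg i _ _ hdist)).2
      linarith
    · have hle' : (x i : ℝ) ≤ Fintype.card I := by exact_mod_cast hle
      have h1 : (x i : ℝ) / N ≤ Fintype.card I / N := by gcongr
      have h2 := (f ⟨_, hmem x hx⟩).2.1 i
      have h3 : g i ⟨_, hmem x hx⟩ ≤ (x i : ℝ) / N := sub_le_self _ h2
      linarith
  -- A minimiser of the total positive part of the `g i` beats all approximate fixed points, so its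
  -- positive parts vanish; as the `g i` sum to zero, they all vanish.
  obtain ⟨x, -, hx⟩ := isCompact_univ.exists_isMinOn (Set.univ_nonempty (α := stdSimplex ℝ I))
    (f := fun x => ∑ i, max (g i x) 0)
    (continuous_finsetSum _ fun i _ => (hg i).max continuous_const).continuousOn
  have hle : ∀ i, g i x ≤ 0 := by
    intro i
    have hcard : (0 : ℝ) < Fintype.card I := by exact_mod_cast Fintype.card_pos
    refine le_of_forall_pos_le_add fun ε hε => ?_
    obtain ⟨y, hy⟩ := happrox (ε / Fintype.card I) (by positivity)
    calc g i x ≤ max (g i x) 0 := le_max_left _ _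
      _ ≤ ∑ i, max (g i x) 0 :=
        Finset.single_le_sum (f := fun i => max (g i x) 0) (fun _ _ => le_max_right _ _)
          (Finset.mem_univ i)
      _ ≤ ∑ i, max (g i y) 0 := hx (Set.mem_univ y)
      _ ≤ ∑ _i : I, ε / Fintype.card I :=
        Finset.sum_le_sum fun i _ => max_le (hy i) (by positivity)
      _ = 0 + ε := by
        rw [Finset.sum_const, Finset.card_univ, nsmul_eq_mul, zero_add]
        field_simp
  have hzero : ∑ i, g i x = 0 := by simp [g, Finset.sum_sub_distrib]
  refine ⟨x, stdSimplex.ext (funext fun i => ?_)⟩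
  have := (Finset.sum_eq_zero_iff_of_nonpos fun i _ => hle i).1 hzero i (Finset.mem_univ i)
  exact (sub_eq_zero.1 this).symm

/-- The **Knaster–Kuratowski–Mazurkiewicz lemma**. -/
theorem exists_mem_of_isClosed_of_forall_stdSimplex {I : Type*} [Fintype I] [Nonempty I]
    {G : I → Set (stdSimplex ℝ I)} (hG : ∀ i, IsClosed (G i))
    (hcover : ∀ w : stdSimplex ℝ I, ∃ i, 0 < w i ∧ w ∈ G i) : ∃ w, ∀ i, w ∈ G i := by
  classical
  by_contra! hno
  -- Needed because `Metric.infDist` to the empty set is `0`. The cover at vertex `i` can only use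
  -- `G i`.
  have hne : ∀ i, (G i).Nonempty := by
    intro i
    obtain ⟨j, hj, hjG⟩ := hcover (stdSimplex.vertex i)
    rw [stdSimplex.vertex_coe] at hj
    obtain rfl : j = i := by
      by_contra h
      simp [h] at hj
    exact ⟨_, hjG⟩
  let d : I → stdSimplex ℝ I → ℝ := fun i w => Metric.infDist w (G i)
  have hd : ∀ i w, 0 ≤ d i w := fun i w => Metric.infDist_nonneg
  have hdc : ∀ i, Continuous (d i) := fun i => Metric.continuous_infDist_pt _
  have hpos : ∀ w, 0 < ∑ i, d i w := by
    intro w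
    obtain ⟨i, hi⟩ := hno w
    exact Finset.sum_pos' (fun i _ => hd i w)
      ⟨i, Finset.mem_univ i, ((hG i).notMem_iff_infDist_pos (hne i)).1 hi⟩
  -- The weights are normalised distances to the sets `G i`. At a fixed point every `i` with
  -- positive weight has `w ∉ G i`, against the cover.
  let f : stdSimplex ℝ I → stdSimplex ℝ I := fun w => ⟨fun i => d i w / ∑ j, d j w,
    fun i => div_nonneg (hd i w) (hpos w).le, by rw [← Finset.sum_div, div_self (hpos w).ne']⟩
  have hf : Continuous f := Continuous.subtype_mk (continuous_pi fun i =>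
    (hdc i).div (continuous_finsetSum _ fun j _ => hdc j) fun w => (hpos w).ne') _
  obtain ⟨w, hw⟩ := exists_fixedPoint_stdSimplex hf
  obtain ⟨i, hi, hiG⟩ := hcover w
  have hwi : d i w / ∑ j, d j w = w i := congrArg (fun v : stdSimplex ℝ I => v i) hw
  rw [← hwi, show d i w = 0 from Metric.infDist_zero_of_mem hiG, zero_div] at hi
  exact lt_irrefl _ hi

/-! ### Self segment-dense sets and the minimax principle -/

section TopologicalVectorSpace

variable {E : Type*} [AddCommGroup E] [Module ℝ E] [TopologicalSpace E] [ContinuousAdd E]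
  [ContinuousSMul ℝ E]

/-- Induction on the vertices. A point of the hull lies on a segment from `x` to some `q` in the
smaller hull; `q` is approximated by `q' ∈ D`, and then segment-density applies to `[x, q']`. The
two approximations account for the double closure. -/
theorem convexHull_subset_closure_convexHull_inter {D : Set E}
    (hD : ∀ x ∈ D, ∀ y ∈ D, segment ℝ x y ⊆ closure (segment ℝ x y ∩ D)) (s : Finset E)
    (hs : (s : Set E) ⊆ D) : convexHull ℝ (s : Set E) ⊆ closure (convexHull ℝ s ∩ D) := by
  classical
  induction s using Finset.induction_on with
  | empty => simp
  | insert x s hx ih =>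
    rw [Finset.coe_insert] at hs ⊢
    obtain ⟨hxD, hsD⟩ := Set.insert_subset_iff.1 hs
    rcases (s : Set E).eq_empty_or_nonempty with h | h
    · rw [h]
      simpa using subset_closure (show x ∈ {x} ∩ D from ⟨rfl, hxD⟩)
    intro p hp
    rw [convexHull_insert h, convexJoin_singleton_left, Set.mem_iUnion₂] at hp
    obtain ⟨q, hq, a, b, ha, hb, hab, rfl⟩ := hp
    rw [← closure_closure]
    have hcont : Continuous fun q : E => a • x + b • q := by fun_prop
    refine map_mem_closure (f := fun q : E => a • x + b • q) hcont (ih hsD hq) fun q' hq' => ?_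
    refine closure_mono (Set.inter_subset_inter_left D ?_)
      (hD x hxD q' hq'.2 ⟨a, b, ha, hb, hab, rfl⟩)
    exact (convex_convexHull ℝ _).segment_subset (subset_convexHull ℝ _ (Set.mem_insert _ _))
      (convexHull_mono (Set.subset_insert _ _) hq'.1)

/-- A minimax principle of Ky Fan type for a relation `R` whose sections are open in `K`. -/
theorem IsCompact.exists_forall_not_of_convexHull {B K D : Set E} (hB : IsCompact B)
    (hBcl : IsClosed B) (hBconv : Convex ℝ B) (hBne : B.Nonempty) (hBK : B ⊆ K) (hDK : D ⊆ K)
    (hD : ∀ x ∈ D, ∀ y ∈ D, segment ℝ x y ⊆ closure (segment ℝ x y ∩ D)) {R : E → E → Prop}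
    (hopen : ∀ y ∈ D, ∀ x ∈ K, R x y → ∀ᶠ u in 𝓝[K] x, R u y)
    (hhull : ∀ u ∈ D, ∀ s : Finset E, (s : Set E) ⊆ D → u ∈ convexHull ℝ (s : Set E) →
      ∃ y ∈ s, ¬ R u y) :
    ∃ x ∈ B, ∀ y ∈ D ∩ B, ¬ R x y := by
  classical
  let F : E → Set E := fun y => {x | x ∈ B ∧ ¬ R x y}
  have hF : ∀ y ∈ D, IsClosed (F y) := by
    intro y hy
    refine isClosed_of_closure_subset fun x hx => ?_
    have hxB : x ∈ B := hBcl.closure_subset_iff.2 (fun z hz => hz.1) hx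
    refine ⟨hxB, fun hR => ?_⟩
    obtain ⟨u, hu, huF⟩ := ((mem_closure_iff_frequently.1 hx).and_eventually
      (eventually_nhdsWithin_iff.1 (hopen y hy x (hBK hxB) hR))).exists
    exact hu.2 (huF (hBK hu.1))
  obtain ⟨x, hxB, hx⟩ := hB.inter_iInter_nonempty (fun y : (D ∩ B : Set E) => F y)
    (fun y => hF y y.2.1) fun s => by
      rcases s.eq_empty_or_nonempty with rfl | hs
      · simpa using hBne
      have : Nonempty s := hs.coe_sort
      let φ : stdSimplex ℝ s → E := fun w => ∑ i, w i • (i : E)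
      have hφ : Continuous φ := continuous_finsetSum _ fun i _ =>
        ((continuous_apply i).comp continuous_subtype_val).smul continuous_const
      have hφB : ∀ w, φ w ∈ B := fun w =>
        hBconv.sum_mem (fun i _ => w.2.1 i) w.2.2 fun i _ => i.1.2.2
      obtain ⟨w, hw⟩ := exists_mem_of_isClosed_of_forall_stdSimplex
        (G := fun i : s => φ ⁻¹' F i) (fun i => (hF i i.1.2.1).preimage hφ) fun w => by
          by_contra! hno
          have hR : ∀ i, 0 < w i → R (φ w) i := fun i hi => by
            by_contra h
            exact hno i hi ⟨hφB w, h⟩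
          -- Only vertices of positive weight matter: `φ w` lies in their hull, and `R (φ w)` holds
          -- at each of them.
          let s' : Finset E :=
            Finset.image (fun i : s => i.1.1) (Finset.univ.filter fun i : s => 0 < w i)
          have hs'D : (s' : Set E) ⊆ D := by
            intro y hy
            obtain ⟨i, -, rfl⟩ := Finset.mem_image.1 (Finset.mem_coe.1 hy)
            exact i.1.2.1
          have hzero : ∀ i, i ∉ (Finset.univ.filter fun i : s => 0 < w i) → w i = 0 := by
            intro i hi
            refine le_antisymm ?_ (w.2.1 i)
            simpa using hi
          have hmem : φ w ∈ convexHull ℝ (s' : Set E) := by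
            have hφw : φ w = ∑ i ∈ Finset.univ.filter fun i : s => 0 < w i, w i • (i : E) :=
              (Finset.sum_subset (Finset.subset_univ _) fun i _ hi => by
                rw [hzero i hi, zero_smul]).symm
            rw [hφw]
            refine (convex_convexHull ℝ _).sum_mem (fun i _ => w.2.1 i) ?_ fun i hi =>
              subset_convexHull ℝ _ (Finset.mem_coe.2 (Finset.mem_image_of_mem (fun i : s => i.1.1) hi))
            exact (Finset.sum_subset (Finset.subset_univ _) fun i _ hi => hzero i hi).trans w.2.2
          -- `φ w` need not lie in `D`, where `hhull` applies. Openness of finitely many relations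
          -- allows moving to a nearby `u ∈ D` in the same hull.
          have hev : ∀ᶠ u in 𝓝[K] (φ w), ∀ y ∈ s', R u y := by
            rw [Filter.eventually_all_finset]
            intro y hy
            obtain ⟨i, hi, rfl⟩ := Finset.mem_image.1 hy
            exact hopen _ i.1.2.1 _ (hBK (hφB w)) (hR i (Finset.mem_filter.1 hi).2)
          obtain ⟨u, hu, huR⟩ := ((mem_closure_iff_frequently.1
            (convexHull_subset_closure_convexHull_inter hD s' hs'D hmem)).and_eventually
            (eventually_nhdsWithin_iff.1 hev)).exists
          obtain ⟨y, hy, hyR⟩ := hhull u hu.2 s' hs'D hu.1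
          exact hyR (huR (hDK hu.2) y hy)
      exact ⟨φ w, hφB w, Set.mem_iInter₂.2 fun i hi => hw ⟨i, hi⟩⟩
  exact ⟨x, hxB, fun y hy => (Set.mem_iInter.1 hx ⟨y, hy⟩).2⟩

end TopologicalVectorSpace

/-! ### Semicontinuity and Jensen's inequality for cones -/

/-- The choice `k = -g x` turns `g x + k` into `0`. -/
theorem StronglyUpperSemicontinuousAt.eventually_mem_neg_diff {E Z : Type*} [TopologicalSpace E]
    [AddCommGroup Z] {C : Set Z} {K : Set E} {g : E → Z} {x : E} (h : StronglyUpperSemicontinuousAt C K g x)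
    (hx : g x ∈ (-C) \ {0}) : ∀ᶠ u in 𝓝[K] x, g u ∈ (-C) \ {0} := by
  obtain ⟨U, hU, hUK⟩ := h (-g x) ⟨hx.1, fun h => hx.2 (neg_eq_zero.1 h)⟩
  rw [eventually_nhdsWithin_iff]
  filter_upwards [hU] with u hu huK
  have hmem := hUK u ⟨hu, huK⟩
  rw [add_neg_cancel, Set.singleton_sub] at hmem
  obtain ⟨k, hk, hku⟩ := hmem
  have hku : g u = -k := hku.symm.trans (zero_sub k)
  rw [hku]
  exact ⟨by simpa using hk.1, fun h => hk.2 (neg_eq_zero.1 h)⟩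

section Cone

variable {Z : Type*} [AddCommGroup Z] [Module ℝ Z] {C : Set Z}

theorem IsConvexPointedCone.zero_mem (hC : IsConvexPointedCone C) : (0 : Z) ∈ C :=
  (hC.inter_neg_eq.symm ▸ Set.mem_singleton (0 : Z) : (0 : Z) ∈ C ∩ -C).1

theorem IsConvexPointedCone.add_mem (hC : IsConvexPointedCone C) {a b : Z} (ha : a ∈ C)
    (hb : b ∈ C) : a + b ∈ C := hC.add_eq ▸ Set.add_mem_add ha hb

/-- Pointedness: a zero sum would put `a` in both `C` and `-C`. -/
theorem IsConvexPointedCone.add_mem_neg_diff (hC : IsConvexPointedCone C) {a b : Z}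
    (ha : a ∈ (-C) \ {0}) (hb : b ∈ -C) : a + b ∈ (-C) \ {0} := by
  refine ⟨?_, fun h => ha.2 ?_⟩
  · rw [Set.mem_neg, neg_add]
    exact hC.add_mem ha.1 hb
  · have hab : a = -b := eq_neg_of_add_eq_zero_left h
    have : a ∈ C ∩ -C := ⟨hab ▸ hb, ha.1⟩
    rwa [hC.inter_neg_eq] at this

theorem IsConvexPointedCone.smul_mem_neg (hC : IsConvexPointedCone C) {t : ℝ} (ht : 0 ≤ t) {a : Z}
    (ha : a ∈ -C) : t • a ∈ -C := by
  rw [Set.mem_neg, ← smul_neg]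
  exact hC.smul_mem t ht _ ha

theorem IsConvexPointedCone.smul_mem_neg_diff (hC : IsConvexPointedCone C) {t : ℝ} (ht : 0 < t)
    {a : Z} (ha : a ∈ (-C) \ {0}) : t • a ∈ (-C) \ {0} :=
  ⟨hC.smul_mem_neg ht.le ha.1, fun h => ha.2 ((smul_eq_zero.1 h).resolve_left ht.ne')⟩

theorem IsConvexPointedCone.sum_smul_mem_neg_diff (hC : IsConvexPointedCone C) {I : Type*}
    [Fintype I] {w : I → ℝ} (hw : ∀ i, 0 ≤ w i) (hw1 : ∑ i, w i = 1) {a : I → Z}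
    (ha : ∀ i, a i ∈ (-C) \ {0}) : ∑ i, w i • a i ∈ (-C) \ {0} := by
  classical
  obtain ⟨i, -, hi⟩ : ∃ i ∈ Finset.univ, w i ≠ 0 :=
    Finset.exists_ne_zero_of_sum_ne_zero (hw1 ▸ one_ne_zero)
  rw [← Finset.add_sum_erase _ _ (Finset.mem_univ i)]
  refine hC.add_mem_neg_diff (hC.smul_mem_neg_diff ((hw i).lt_of_ne hi.symm) (ha i)) ?_
  refine Finset.sum_induction _ (· ∈ -C) (fun a b ha hb => ?_) ?_
    fun j _ => hC.smul_mem_neg (hw j) (ha j).1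
  · rw [Set.mem_neg, neg_add]
    exact hC.add_mem ha hb
  · simpa using hC.zero_mem

theorem ConeConvexOn.image_linearEquiv {E E' : Type*} [AddCommGroup E] [Module ℝ E]
    [AddCommGroup E'] [Module ℝ E'] {D : Set E} {g : E → Z} (h : ConeConvexOn C D g)
    (e : E ≃ₗ[ℝ] E') : ConeConvexOn C (e '' D) fun y => g (e.symm y) := by
  have hmem : ∀ y, y ∈ e '' D → e.symm y ∈ D := by
    rintro _ ⟨x, hx, rfl⟩
    simpa using hx
  intro n x w hx hw hw1 hsum
  have := h n (fun i => e.symm (x i)) w (fun i => hmem _ (hx i)) hw hw1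
    (by simpa only [map_sum, map_smul] using hmem _ hsum)
  simpa only [map_sum, map_smul] using this

/-- By Jensen, `g u` is a convex combination of the values on `s` plus an element of `-C`. -/
theorem ConeConvexOn.mem_neg_diff_of_mem_convexHull {E : Type*} [AddCommGroup E] [Module ℝ E]
    {D : Set E} {g : E → Z} (h : ConeConvexOn C D g) (hC : IsConvexPointedCone C) {u : E}
    (hu : u ∈ D) {s : Finset E} (hs : (s : Set E) ⊆ D) (hus : u ∈ convexHull ℝ (s : Set E))
    (hg : ∀ y ∈ s, g y ∈ (-C) \ {0}) : g u ∈ (-C) \ {0} := by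
  obtain ⟨w, hw, hw1, hwu⟩ := Finset.mem_convexHull'.1 hus
  let e := s.equivFin.symm
  have hsum : ∀ {M : Type _} [AddCommMonoid M] (F : E → M), ∑ i, F (e i) = ∑ y ∈ s, F y := by
    intro M _ F
    rw [e.sum_comp fun y : s => F y, Finset.sum_coe_sort]
  have hw1' : ∑ i, w (e i) = 1 := (hsum w).trans hw1
  have hwu' : ∑ i, w (e i) • (e i : E) = u := by
    rw [e.sum_comp fun y : s => w y • (y : E), Finset.sum_coe_sort s fun y => w y • y, hwu]
  have hconv := h s.card (fun i => e i) (fun i => w (e i)) (fun i => hs (e i).2)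
    (fun i => hw _ (e i).2) hw1' (hwu'.symm ▸ hu)
  rw [hwu'] at hconv
  have := hC.add_mem_neg_diff (hC.sum_smul_mem_neg_diff (fun i => hw _ (e i).2) hw1'
    fun i => hg _ (e i).2) (b := -(∑ i, w (e i) • g (e i) - g u)) (by simpa using hconv)
  simpa using this

/-- Jensen for two points: as `g x = 0`, only the term `b • g y` with `b > 0` remains. -/
theorem ConeConvexOn.mem_neg_diff_of_eq_zero {E : Type*} [AddCommGroup E] [Module ℝ E]
    {D : Set E} {g : E → Z} (h : ConeConvexOn C D g) (hC : IsConvexPointedCone C) {x y : E}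
    (hx : x ∈ D) (hy : y ∈ D) (hgx : g x = 0) (hgy : g y ∈ (-C) \ {0}) {a b : ℝ} (ha : 0 ≤ a)
    (hb : 0 < b) (hab : a + b = 1) (hmem : a • x + b • y ∈ D) :
    g (a • x + b • y) ∈ (-C) \ {0} := by
  have hconv := h 2 ![x, y] ![a, b] (by simp [Fin.forall_fin_two, hx, hy])
    (by simp [Fin.forall_fin_two, ha, hb.le]) (by simpa using hab) (by simpa using hmem)
  simp only [Fin.sum_univ_two, Matrix.cons_val_zero, Matrix.cons_val_one, hgx, smul_zero,
    zero_add] at hconv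
  have := hC.add_mem_neg_diff (hC.smul_mem_neg_diff hb hgy)
    (b := -(b • g y - g (a • x + b • y))) (by simpa using hconv)
  simpa using this

end Cone

/-! ### Weak compactness and weak density on segments -/

/-- Reflexivity makes the weak closure of a bounded set compact, and by Mazur a closed convex set is
already weakly closed. -/
theorem IsReflexiveSpace.isCompact_toWeakSpace_image {X : Type*} [NormedAddCommGroup X]
    [NormedSpace ℝ X] (hX : IsReflexiveSpace X) {B : Set X} (hB : Bornology.IsBounded B)
    (hconv : Convex ℝ B) (hcl : IsClosed B) : IsCompact (toWeakSpace ℝ X '' B) := by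
  have h := NormedSpace.isCompact_closure_of_isBounded ℝ X (toWeakSpace ℝ X '' B)
    (by rwa [Set.preimage_image_eq _ (toWeakSpace ℝ X).injective]) fun φ _ => by
      obtain ⟨x, hx⟩ := hX φ.toStrongDual
      exact ⟨toWeakSpace ℝ X x, hx⟩
  rwa [← hconv.toWeakSpace_closure ℝ, hcl.closure_eq] at h

/-- Near an end point `x` of a segment, weak density of a set in the segment gives points of the
set that are close to `x` in norm. -/
theorem exists_smul_add_smul_mem_norm_lt {X : Type*} [NormedAddCommGroup X] [NormedSpace ℝ X]
    {D : Set X} {x y : X} (hxy : x ≠ y) {r : ℝ} (hxr : ‖x‖ < r)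
    (hD : segment ℝ (toWeakSpace ℝ X x) (toWeakSpace ℝ X y) ⊆
      closure (segment ℝ (toWeakSpace ℝ X x) (toWeakSpace ℝ X y) ∩ toWeakSpace ℝ X '' D)) :
    ∃ a b : ℝ, 0 ≤ a ∧ 0 < b ∧ a + b = 1 ∧ a • x + b • y ∈ D ∧ ‖a • x + b • y‖ < r := by
  have hpos : 0 < ‖y - x‖ := norm_pos_iff.2 (sub_ne_zero.2 hxy.symm)
  -- A functional norming `y - x` reads off the position on the segment, so a weakly open strip cut
  -- out by `l` controls the norm distance to `x`.
  obtain ⟨l, -, hl⟩ := exists_dual_vector ℝ (y - x) hpos.ne'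
  replace hl : l (y - x) = ‖y - x‖ := hl
  have hcont : Continuous fun u : WeakSpace ℝ X => l ((toWeakSpace ℝ X).symm u) :=
    WeakBilin.eval_continuous (topDualPairing ℝ X).flip l
  have hval : ∀ a b : ℝ, a + b = 1 → l (a • x + b • y) - l x = b * ‖y - x‖ := by
    intro a b hab
    obtain rfl : a = 1 - b := by linarith
    rw [← hl]
    simp only [map_add, map_smul, map_sub, smul_eq_mul]
    ring
  let δ := r - ‖x‖
  have hδ : 0 < δ := sub_pos.2 hxr
  -- Chosen so that `0 < t ≤ 1` and `t * ‖y - x‖ < δ`: the point with parameter `t` shows that the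
  -- strip meets the segment.
  let t := δ / (‖y - x‖ + δ)
  have ht : 0 < t := by positivity
  have ht1 : t ≤ 1 := (div_le_one (by positivity)).2 (by linarith)
  have htδ : t * ‖y - x‖ < δ := by
    rw [div_mul_eq_mul_div, div_lt_iff₀ (by positivity)]
    nlinarith
  let U : Set (WeakSpace ℝ X) := {u | 0 < l ((toWeakSpace ℝ X).symm u) - l x ∧
    l ((toWeakSpace ℝ X).symm u) - l x < δ}
  have hU : IsOpen U := (isOpen_lt continuous_const (hcont.sub continuous_const)).inter
    (isOpen_lt (hcont.sub continuous_const) continuous_const)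
  have hsymm : ∀ a b : ℝ, (toWeakSpace ℝ X).symm (a • toWeakSpace ℝ X x + b • toWeakSpace ℝ X y) =
      a • x + b • y := fun a b => by simp
  obtain ⟨_, ⟨h0, h1⟩, ⟨a, b, ha, hb, hab, rfl⟩, z, hz, hzu⟩ := mem_closure_iff.1
    (hD ⟨1 - t, t, by linarith, ht.le, by ring, rfl⟩) U hU (by
      refine ⟨?_, ?_⟩ <;> rw [hsymm, hval _ _ (by ring)]
      exacts [by positivity, htδ])
  rw [hsymm, hval a b hab] at h0 h1
  have hz' : z = a • x + b • y := by
    rw [← hsymm, ← hzu, LinearEquiv.symm_apply_apply]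
  refine ⟨a, b, ha, pos_of_mul_pos_left h0 hpos.le, hab, hz' ▸ hz, ?_⟩
  have heq : a • x + b • y = x + b • (y - x) := by
    obtain rfl : a = 1 - b := by linarith
    module
  calc ‖a • x + b • y‖ ≤ ‖x‖ + ‖b • (y - x)‖ := heq ▸ norm_add_le _ _
    _ = ‖x‖ + b * ‖y - x‖ := by rw [norm_smul, Real.norm_of_nonneg hb]
    _ < r := by linarith

/-! ### The equilibrium theorem -/

theorem theoremt23
    {X : Type*} [NormedAddCommGroup X] [NormedSpace ℝ X] [CompleteSpace X]
    (hX : IsReflexiveSpace X)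
    {Z : Type*} [AddCommGroup Z] [Module ℝ Z] [TopologicalSpace Z] [IsTopologicalAddGroup Z]
    [ContinuousSMul ℝ Z] [T2Space Z] [LocallyConvexSpace ℝ Z]
    (C : Set Z) (hC : IsConvexPointedCone C)
    (K D : Set X) (hK_nonempty : K.Nonempty) (hK_convex : Convex ℝ K) (hK_closed : IsClosed K)
    (hDK : D ⊆ K)
    (hD : IsSelfSegmentDense (toWeakSpace ℝ X '' D) (toWeakSpace ℝ X '' K))
    -- only the values of `f` on `K × K` are used
    (f : X → X → Z)
    (h_i : ∀ y ∈ D, ∀ x ∈ K,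
      StronglyUpperSemicontinuousAt C (toWeakSpace ℝ X '' K)
        (fun u => f ((toWeakSpace ℝ X).symm u) y) (toWeakSpace ℝ X x))
    (h_ii : ∀ x ∈ K, ∀ y ∈ K \ D,
      StronglyUpperSemicontinuousAt C (toWeakSpace ℝ X '' K)
        (fun v => f x ((toWeakSpace ℝ X).symm v)) (toWeakSpace ℝ X y))
    (h_iii : ∀ x ∈ K, ConeConvexOn C D (fun y => f x y))
    (h_iv : ∀ x ∈ D, f x x ∉ (-C) \ {0})
    (h_v : ∃ r : ℝ, 0 < r ∧ (∃ x ∈ K, ‖x‖ ≤ r) ∧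
      ∀ x ∈ K, ‖x‖ ≤ r → ∃ y₀ ∈ D, ‖y₀‖ < r ∧ f x y₀ ∈ -C) :
    ∃ x₀ ∈ K, ∀ y ∈ K, f x₀ y ∉ (-C) \ {0} := by
  obtain ⟨r, -, ⟨b, hbK, hbr⟩, hcoer⟩ := h_v
  let ι := toWeakSpace ℝ X
  let B : Set X := K ∩ Metric.closedBall 0 r
  have hBconv : Convex ℝ B := hK_convex.inter (convex_closedBall 0 r)
  have hBcl : IsClosed B := hK_closed.inter Metric.isClosed_closedBall
  have hBmem : ∀ x, x ∈ B ↔ x ∈ K ∧ ‖x‖ ≤ r := fun x => by simp [B]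
  have hBw : IsClosed (ι '' B) := by
    have h := hBconv.toWeakSpace_closure ℝ
    rw [hBcl.closure_eq] at h
    exact closure_eq_iff_isClosed.1 h.symm
  obtain ⟨_, ⟨x₀, hx₀, rfl⟩, hsol⟩ := IsCompact.exists_forall_not_of_convexHull
    (hX.isCompact_toWeakSpace_image
      (Metric.isBounded_closedBall.subset Set.inter_subset_right) hBconv hBcl) hBw
    (hBconv.linear_image (toWeakSpace ℝ X).toLinearMap)
    ⟨ι b, b, (hBmem b).2 ⟨hbK, hbr⟩, rfl⟩ (Set.image_mono Set.inter_subset_left) hD.subset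
    hD.segment_dense (R := fun u y => f (ι.symm u) (ι.symm y) ∈ (-C) \ {0})
    (by
      rintro _ ⟨y, hy, rfl⟩ _ ⟨x, hx, rfl⟩ hR
      have h := (h_i y hy x hx).eventually_mem_neg_diff (by simpa [ι] using hR)
      simpa [ι] using h)
    (by
      rintro _ ⟨u, hu, rfl⟩ s hs hus
      by_contra! hall
      have h := ((h_iii u (hDK hu)).image_linearEquiv ι).mem_neg_diff_of_mem_convexHull hC
        (Set.mem_image_of_mem _ hu) hs hus fun y hy => by simpa [ι] using hall y hy
      exact h_iv u hu (by simpa [ι] using h))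
  have hsolB : ∀ y ∈ D, ‖y‖ ≤ r → f x₀ y ∉ (-C) \ {0} := fun y hy hyr => by
    simpa [ι] using hsol (ι y) ⟨⟨y, hy, rfl⟩, y, (hBmem y).2 ⟨hDK hy, hyr⟩, rfl⟩
  obtain ⟨hx₀K, hx₀r⟩ := (hBmem x₀).1 hx₀
  obtain ⟨y₀, hy₀D, hy₀r, hy₀⟩ := hcoer x₀ hx₀K hx₀r
  -- `y₀` lies in `D` and in the ball, so `f x₀ y₀ ∈ -C` leaves only the value `0`.
  have hzero : f x₀ y₀ = 0 := by
    by_contra h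
    exact hsolB y₀ hy₀D hy₀r.le ⟨hy₀, h⟩
  have hsolD : ∀ y ∈ D, f x₀ y ∉ (-C) \ {0} := by
    intro y hy hmem
    have hne : y₀ ≠ y := by
      rintro rfl
      exact hmem.2 hzero
    -- The strict bound `‖y₀‖ < r` leaves room to move from `y₀` towards `y` inside the ball; the
    -- point reached is again bad.
    obtain ⟨a, b, ha, hb, hab, hzD, hzr⟩ := exists_smul_add_smul_mem_norm_lt hne hy₀r
      (hD.segment_dense _ ⟨y₀, hy₀D, rfl⟩ _ ⟨y, hy, rfl⟩)
    exact hsolB _ hzD hzr.le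
      ((h_iii x₀ hx₀K).mem_neg_diff_of_eq_zero hC hy₀D hy hzero hmem ha hb hab hzD)
  refine ⟨x₀, hx₀K, fun y hy hmem => ?_⟩
  by_cases hyD : y ∈ D
  · exact hsolD y hyD hmem
  -- Badness at `y ∉ D` spreads to a weak neighbourhood in `K`, which meets `D` by density.
  have hev := (h_ii x₀ hx₀K y ⟨hy, hyD⟩).eventually_mem_neg_diff (by simpa using hmem)
  obtain ⟨_, ⟨v, hv, rfl⟩, hvf⟩ := ((mem_closure_iff_frequently.1
    (hD.dense ⟨y, hy, rfl⟩)).and_eventually (eventually_nhdsWithin_iff.1 hev)).exists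
  exact hsolD v hv (by simpa using hvf ⟨v, hDK hv, rfl⟩)
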